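/- **Double Cut Lemma.** Let $n\ge 3$, let $1+\frac4n<p<1+\frac4{n-2}$, and put $s_c=\frac n2-\frac2{p-1}\in(0,1)$. Write $\|\cdot\|_q$ for the norm of $L^q(\mathbb R^n)$ and $\nabla$ for the distributional gradient. Let $C_{GN}$ be the sharp constant of the Gagliardo–Nirenberg inequality $$\|v\|_{p+1}^{p+1}\le C_{GN}\,\|\nabla v\|_2^{\frac{n(p-1)}2}\,\|v\|_2^{2-\frac{(n-2)(p-1)}2}\qquad (v\in H^1(\mathbb R^n;\mathbb C)).$$ Let $Q:\mathbb R^n\to(0,\infty)$ be a ground state, i.e. a smooth positive $H^1$ function that attains equality in this inequality, normalized (in amplitude and length scale) so that $\|\nabla Q\|_2=\|Q\|_2$ and $\|Q\|_{p+1}^{p+1}=\frac{p+1}2\|Q\|_2^2$. Let $u_Q(x,t)=e^{i\lambda t}Q(\alpha x)$ with $\alpha=\frac{\sqrt{n(p-1)}}2$ and $\lambda=1-\frac{(n-2)(p-1)}4$; norms and energies of $u_Q$ are taken in $x$ at an arbitrary fixed time $t\in\mathbb R$. Let $A\in L^2_{\rm loc}(\mathbb R^n;\mathbb R^n)$, let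 $\nabla_A u=\nabla u+iAu$ in the sense of distributions, and let $H^1_A=\{u\in L^2(\mathbb R^n;\mathbb C):\nabla_A u\in L^2\}$. Set $$E_A[u]=\tfrac12\|\nabla_A u\|_2^2-\tfrac1{p+1}\|u\|_{p+1}^{p+1},\qquad E[u]=\tfrac12\|\nabla u\|_2^2-\tfrac1{p+1}\|u\|_{p+1}^{p+1}.$$ For $E<0$ the power $E^{s_c}$ is read as $-|E|^{s_c}$. Then every $u\in H^1_A$ satisfies $u\in L^{p+1}$ and $|u|\in H^1(\mathbb R^n)$ (so that all quantities below are well defined and finite). Moreover, for $$\mathcal R=\{u\in H^1_A:\ E_A[u]^{s_c}\|u\|_2^{2(1-s_c)}<E[u_Q]^{s_c}\|u_Q\|_2^{2(1-s_c)}\}$$ there are two disjoint sets $\mathcal R_1,\mathcal R_2$ with $\mathcal R=\mathcal R_1\cup\mathcal R_2$ such that for every $u\in\mathcal R_1$ $$\|\nabla|u|\|_2^{s_c}\|u\|_2^{1-s_c}\le\|\nabla_A u\|_2^{s_c}\|u\|_2^{1-s_c}<\|\nabla u_Q\|_2^{s_c}\|u_Q\|_2^{1-s_c},$$ and for every $u\in\mathcal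 R_2$ $$\|\nabla u_Q\|_2^{s_c}\|u_Q\|_2^{1-s_c}<\|\nabla|u|\|_2^{s_c}\|u\|_2^{1-s_c}\le\|\nabla_A u\|_2^{s_c}\|u\|_2^{1-s_c}.$$ -/

import Mathlib

open MeasureTheory Set
open scoped ENNReal ContDiff

noncomputable section

namespace EMNLS

/-- Physical space `ℝⁿ` with the Euclidean norm. -/
abbrev Space (n : ℕ) : Type := EuclideanSpace ℝ (Fin n)

/-- The space `ℂⁿ` with the Euclidean norm, in which gradients of complex functions live. -/
abbrev CVec (n : ℕ) : Type := EuclideanSpace ℂ (Fin n)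

/-- The (locally integrable) vector field `g` is the distributional gradient of the locally
integrable function `u`: `∫ u ∂ⱼφ = - ∫ gⱼ φ` for all test functions `φ ∈ C_c^∞(ℝⁿ)`. -/
def HasWeakGrad {n : ℕ} (u : Space n → ℂ) (g : Space n → CVec n) : Prop :=
  LocallyIntegrable u volume ∧ LocallyIntegrable g volume ∧
    ∀ φ : Space n → ℝ, ContDiff ℝ ∞ φ → HasCompactSupport φ → ∀ j : Fin n,
      ∫ x, (fderiv ℝ φ x (EuclideanSpace.single j 1)) • u x = - ∫ x, φ x • g x j

open Classical in
/-- The distributional gradient `∇u` (unique up to null sets when it exists as a locally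
integrable field; zero if there is none). -/
def weakGrad {n : ℕ} (u : Space n → ℂ) : Space n → CVec n :=
  if h : ∃ g, HasWeakGrad u g then h.choose else fun _ => 0

/-- Given a gradient `g` of `u`, the field with components `gⱼ + i Aⱼ u`. -/
def covariant {n : ℕ} (A : Space n → Space n) (u : Space n → ℂ) (g : Space n → CVec n) :
    Space n → CVec n :=
  fun x => WithLp.toLp 2 fun j => g x j + Complex.I * (A x j : ℂ) * u x

/-- The magnetic gradient `∇_A u = (D₁u, …, Dₙu)`, `Dⱼ = ∂ⱼ + i Aⱼ`. -/
def magGrad {n : ℕ} (A : Space n → Space n) (u : Space n → ℂ) : Space n → CVec n :=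
  covariant A u (weakGrad u)

/-- The magnetic potential is in `L²_loc(ℝⁿ; ℝⁿ)`. -/
def MemL2Loc {n : ℕ} (A : Space n → Space n) : Prop :=
  ∀ K : Set (Space n), IsCompact K → MemLp A 2 (volume.restrict K)

/-- `u ∈ H¹(ℝⁿ)`: both `u` and its distributional gradient are in `L²`. -/
def MemH1 {n : ℕ} (u : Space n → ℂ) : Prop :=
  MemLp u 2 volume ∧ ∃ g, HasWeakGrad u g ∧ MemLp g 2 volume

/-- `u ∈ H¹_A(ℝⁿ)`: both `u` and the distribution `∇_A u = ∇u + iAu` are in `L²`. For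
`u ∈ L²` and `A ∈ L²_loc` the product `Au` is locally integrable, so that `∇_A u ∈ L²` makes
`∇u` a locally integrable field. -/
def MemH1A {n : ℕ} (A : Space n → Space n) (u : Space n → ℂ) : Prop :=
  MemLp u 2 volume ∧ ∃ g, HasWeakGrad u g ∧ MemLp (covariant A u g) 2 volume

/-- The modulus `|u|`, as a complex-valued function. -/
def modulus {n : ℕ} (u : Space n → ℂ) : Space n → ℂ := fun x => ((‖u x‖ : ℝ) : ℂ)

/-- The norm `‖f‖_q = ‖f‖_{L^q(ℝⁿ)}` as a real number. -/
def nrm {n : ℕ} {F : Type} [NormedAddCommGroup F] (q : ℝ) (f : Space n → F) : ℝ :=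
  (eLpNorm f (ENNReal.ofReal q) volume).toReal

/-- The critical exponent `s_c = n/2 - 2/(p-1)`. -/
def sc (n : ℕ) (p : ℝ) : ℝ := n / 2 - 2 / (p - 1)

/-- The energy `E[u] = ½‖∇u‖₂² - ‖u‖_{p+1}^{p+1}/(p+1)`. -/
def energy {n : ℕ} (p : ℝ) (u : Space n → ℂ) : ℝ :=
  1 / 2 * nrm 2 (weakGrad u) ^ 2 - 1 / (p + 1) * nrm (p + 1) u ^ (p + 1)

/-- The magnetic energy `E_A[u] = ½‖∇_A u‖₂² - ‖u‖_{p+1}^{p+1}/(p+1)`. -/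
def magEnergy {n : ℕ} (p : ℝ) (A : Space n → Space n) (u : Space n → ℂ) : ℝ :=
  1 / 2 * nrm 2 (magGrad A u) ^ 2 - 1 / (p + 1) * nrm (p + 1) u ^ (p + 1)

/-- The odd power `E^s = sign(E) |E|^s`, which is the usual power for `E ≥ 0` and is negative
for negative `E`. -/
def signedPow (E s : ℝ) : ℝ := if 0 ≤ E then E ^ s else -((-E) ^ s)

/-- The right side of the Gagliardo-Nirenberg inequality without its constant:
`‖∇v‖₂^{n(p-1)/2} ‖v‖₂^{2-(n-2)(p-1)/2}`. -/
def gnProduct {n : ℕ} (p : ℝ) (v : Space n → ℂ) : ℝ≥0∞ :=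
  eLpNorm (weakGrad v) 2 volume ^ ((n : ℝ) * (p - 1) / 2) *
    eLpNorm v 2 volume ^ (2 - ((n : ℝ) - 2) * (p - 1) / 2)

/-- The sharp constant `C_GN`: the least `C ∈ [0,∞]` with
`‖v‖_{p+1}^{p+1} ≤ C ‖∇v‖₂^{n(p-1)/2} ‖v‖₂^{2-(n-2)(p-1)/2}` for all `v ∈ H¹(ℝⁿ)`. -/
def gnConst (n : ℕ) (p : ℝ) : ℝ≥0∞ :=
  sInf {C : ℝ≥0∞ | ∀ v : Space n → ℂ, MemH1 v →
    eLpNorm v (ENNReal.ofReal (p + 1)) volume ^ (p + 1) ≤ C * gnProduct p v}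

/-- `Q` is the ground state: a positive smooth `H¹` function that attains equality in the sharp
Gagliardo-Nirenberg inequality. Optimality is invariant under `Q ↦ a Q(b ·)`; the last two fields
select the amplitude and the length scale. -/
structure IsGroundState {n : ℕ} (p : ℝ) (Q : Space n → ℝ) : Prop where
  pos : ∀ x, 0 < Q x
  smooth : ContDiff ℝ ∞ Q
  memH1 : MemH1 (fun x => (Q x : ℂ))
  optimal : eLpNorm (fun x => (Q x : ℂ)) (ENNReal.ofReal (p + 1)) volume ^ (p + 1) =
    gnConst n p * gnProduct p (fun x => (Q x : ℂ))
  norm_grad : nrm 2 (weakGrad fun x => (Q x : ℂ)) = nrm 2 (fun x => (Q x : ℂ))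
  norm_pow : nrm (p + 1) (fun x => (Q x : ℂ)) ^ (p + 1) =
    (p + 1) / 2 * nrm 2 (fun x => (Q x : ℂ)) ^ 2

/-- The soliton `u_Q(x,t) = e^{iλt} Q(αx)` at time `t`, with `α = √(n(p-1))/2` and
`λ = 1 - (n-2)(p-1)/4`. -/
def soliton {n : ℕ} (p : ℝ) (Q : Space n → ℝ) (t : ℝ) : Space n → ℂ := fun x =>
  Complex.exp (Complex.I * ((1 - ((n : ℝ) - 2) * (p - 1) / 4 : ℝ) : ℂ) * (t : ℂ)) *
    (Q ((Real.sqrt ((n : ℝ) * (p - 1)) / 2) • x) : ℂ)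

/-- The set of `u ∈ H¹_A(ℝⁿ)` with mass-energy below that of `w`:
`E_A[u]^{s_c} ‖u‖₂^{2(1-s_c)} < E[w]^{s_c} ‖w‖₂^{2(1-s_c)}`. -/
def belowSet {n : ℕ} (p : ℝ) (A : Space n → Space n) (w : Space n → ℂ) :
    Set (Lp ℂ 2 (volume : Measure (Space n))) :=
  {u | MemH1A A u ∧
    signedPow (magEnergy p A u) (sc n p) * nrm 2 u ^ (2 * (1 - sc n p)) <
      signedPow (energy p w) (sc n p) * nrm 2 w ^ (2 * (1 - sc n p))}

/-- The scale-invariant quantity `‖G‖₂^{s_c} ‖u‖₂^{1-s_c}`, where `G` is a gradient field. -/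
def kinetic {n : ℕ} (p : ℝ) (G : Space n → CVec n) (u : Space n → ℂ) : ℝ :=
  nrm 2 G ^ sc n p * nrm 2 u ^ (1 - sc n p)

end EMNLS

end

/-! Put `X = ‖∇|u|‖₂ ‖u‖₂^((1-s)/s)`, `Y = ‖∇_A u‖₂ ‖u‖₂^((1-s)/s)` with `s = s_c`, and let `X₀` be
the value of `X` at the soliton. The diamagnetic inequality `|∇|u|| ≤ |∇_A u|` gives `|u| ∈ H¹` and
`X ≤ Y`. The sharp Gagliardo–Nirenberg inequality is applied to `|u|`, not to `u`, and is an
equality at the soliton. After multiplication by the mass factor, being below the soliton becomes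
`½Y² - κC X^b < ½X₀² - κC X₀^b`, where `κ = 1/(p+1)` and `b = n(p-1)/2`. Since `X ≤ Y`, the value `X
= X₀` is impossible, and `X < X₀` makes the subtracted term at most that of the soliton, so `Y <
X₀`. The two sets are therefore separated by the sign of `X - X₀`, and no further shape of the
energy curve is needed (`kinetic_dichotomy`). The analytic core is `HasWeakGrad.modulus`: the weak
gradient of `|u|` is `Re(ū∇u)/|u|`, obtained by mollifying `u` and smoothing the modulus. Given this
formula, `norm_modulusGrad_le` is a pointwise computation. Equality at the soliton is
`IsGroundState.nrm_soliton_rpow`. -/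

namespace EMNLS

open Filter Topology Metric
open ContinuousLinearMap (lsmul)
open scoped Convolution

/-! ### Mollification: convergence in `L¹` and weak derivatives. -/

/-- A sequence that converges almost everywhere and whose `L¹` norms do not exceed that of the
limit converges in `L¹`. -/
theorem tendsto_integral_norm_sub_of_integral_norm_le {α F : Type*} [MeasurableSpace α]
    {μ : Measure α} [NormedAddCommGroup F] {f : ℕ → α → F} {g : α → F}
    (hf : ∀ k, Integrable (f k) μ) (hg : Integrable g μ)
    (hle : ∀ k, ∫ x, ‖f k x‖ ∂μ ≤ ∫ x, ‖g x‖ ∂μ)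
    (hlim : ∀ᵐ x ∂μ, Tendsto (fun k => f k x) atTop (𝓝 (g x))) :
    Tendsto (fun k => ∫ x, ‖f k x - g x‖ ∂μ) atTop (𝓝 0) := by
  -- By the triangle inequality this integrand lies between `0` and `2‖g‖`, so dominated convergence
  -- applies although the `f k` have no common majorant.
  have key : Tendsto (fun k => ∫ x, (‖g x‖ + ‖f k x‖ - ‖f k x - g x‖) ∂μ) atTop
      (𝓝 (∫ x, (‖g x‖ + ‖g x‖ - ‖g x - g x‖) ∂μ)) := by
    refine tendsto_integral_of_dominated_convergence (fun x => 2 * ‖g x‖)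
      (fun k => ((hg.norm.add (hf k).norm).sub ((hf k).sub hg).norm).aestronglyMeasurable)
      (hg.norm.const_mul 2) (fun k => ae_of_all _ fun x => ?_) ?_
    · have h1 := norm_sub_le (f k x) (g x)
      have h2 := norm_sub_norm_le (f k x) (g x)
      have h3 : ‖f k x‖ ≤ ‖f k x - g x‖ + ‖g x‖ := by linarith
      rw [Real.norm_eq_abs, abs_of_nonneg (by linarith)]
      linarith
    · filter_upwards [hlim] with x hx
      exact (hx.norm.const_add _).sub (hx.sub_const _).norm
  have key2 : Tendsto (fun k => 2 * ∫ x, ‖g x‖ ∂μ - ∫ x, (‖g x‖ + ‖f k x‖ - ‖f k x - g x‖) ∂μ)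
      atTop (𝓝 0) := by
    have h0 : 2 * ∫ x, ‖g x‖ ∂μ - ∫ x, (‖g x‖ + ‖g x‖ - ‖g x - g x‖) ∂μ = 0 := by
      simp only [sub_self, norm_zero, sub_zero]
      rw [integral_add hg.norm hg.norm]
      ring
    rw [← h0]
    exact key.const_sub _
  refine squeeze_zero (fun k => integral_nonneg fun x => norm_nonneg _) (fun k => ?_) key2
  have e1 : ∫ x, (‖g x‖ + ‖f k x‖ - ‖f k x - g x‖) ∂μ =
      ∫ x, (‖g x‖ + ‖f k x‖) ∂μ - ∫ x, ‖f k x - g x‖ ∂μ :=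
    integral_sub (hg.norm.add (hf k).norm) ((hf k).sub hg).norm
  have e2 := integral_add hg.norm (hf k).norm
  linarith [hle k]

variable {n : ℕ}

/-- A sequence of bump functions on `ℝⁿ` whose supports shrink to the origin. -/
noncomputable def shrinkingBump (n : ℕ) (k : ℕ) : ContDiffBump (0 : Space n) where
  rIn := 1 / (2 * ((k : ℝ) + 1))
  rOut := 1 / ((k : ℝ) + 1)
  rIn_pos := by positivity
  rIn_lt_rOut := by
    apply one_div_lt_one_div_of_lt <;> nlinarith [(Nat.cast_nonneg k : (0 : ℝ) ≤ k)]

/-- The mollification of `f` at scale `1 / (k + 1)`. -/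
noncomputable def mollify (k : ℕ) (f : Space n → ℂ) : Space n → ℂ :=
  (shrinkingBump n k).normed volume ⋆[lsmul ℝ ℝ, volume] f

theorem shrinkingBump_rOut_le (k : ℕ) : (shrinkingBump n k).rOut ≤ 1 := by
  change 1 / ((k : ℝ) + 1) ≤ 1
  rw [div_le_one (by positivity)]
  linarith [(Nat.cast_nonneg k : (0 : ℝ) ≤ k)]

/-- Lebesgue differentiation; it applies because outer and inner radii keep the fixed ratio 2. -/
theorem ae_tendsto_mollify {f : Space n → ℂ} (hf : LocallyIntegrable f volume) :
    ∀ᵐ x, Tendsto (fun k => mollify k f x) atTop (𝓝 (f x)) := by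
  refine ContDiffBump.ae_convolution_tendsto_right_of_locallyIntegrable (K := 2) ?_ ?_ hf
  · exact tendsto_one_div_add_atTop_nhds_zero_nat
  · refine Eventually.of_forall fun k => le_of_eq ?_
    change 1 / ((k : ℝ) + 1) = 2 * (1 / (2 * ((k : ℝ) + 1)))
    field_simp

theorem integrable_mollify (k : ℕ) {f : Space n → ℂ} (hf : Integrable f) :
    Integrable (mollify k f) :=
  (shrinkingBump n k).integrable_normed.integrable_convolution _ hf

theorem integral_norm_mollify_le (k : ℕ) {f : Space n → ℂ} (hf : Integrable f) :
    ∫ x, ‖mollify k f x‖ ≤ ∫ x, ‖f x‖ := by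
  have h1 : ∀ x, ‖mollify k f x‖ ≤
      ((shrinkingBump n k).normed volume ⋆[lsmul ℝ ℝ, volume] fun y => ‖f y‖) x := by
    intro x
    refine (norm_integral_le_integral_norm _).trans (le_of_eq ?_)
    refine integral_congr_ae (ae_of_all _ fun y => ?_)
    simp [abs_of_nonneg ((shrinkingBump n k).nonneg_normed (μ := volume) y)]
  refine (integral_mono (integrable_mollify k hf).norm
    ((shrinkingBump n k).integrable_normed.integrable_convolution _ hf.norm) h1).trans
    (le_of_eq ?_)
  rw [integral_convolution _ (shrinkingBump n k).integrable_normed hf.norm,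
    (shrinkingBump n k).integral_normed]
  simp

theorem tendsto_integral_norm_mollify_sub {f : Space n → ℂ} (hf : Integrable f) :
    Tendsto (fun k => ∫ x, ‖mollify k f x - f x‖) atTop (𝓝 0) :=
  tendsto_integral_norm_sub_of_integral_norm_le (fun k => integrable_mollify k hf) hf
    (fun k => integral_norm_mollify_le k hf) (ae_tendsto_mollify hf.locallyIntegrable)

theorem contDiff_mollify (k : ℕ) {f : Space n → ℂ} (hf : LocallyIntegrable f) :
    ContDiff ℝ 1 (mollify k f) :=
  HasCompactSupport.contDiff_convolution_left (n := 1) _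
    (shrinkingBump n k).hasCompactSupport_normed (shrinkingBump n k).contDiff_normed hf

/-- On a ball, the functions `u` and `v` satisfy `∂ₑ u = v` weakly. -/
noncomputable def WeakDerivOnBall (R : ℝ) (e : Space n) (u v : Space n → ℂ) : Prop :=
  ∀ φ : Space n → ℝ, ContDiff ℝ ∞ φ → tsupport φ ⊆ closedBall 0 R →
    ∫ x, fderiv ℝ φ x e • u x = -∫ x, φ x • v x

/-- The derivative falls on the kernel, and `t ↦ ρ (x - t)` serves as the test function. Its support
reaches at most distance 1 from `x`, hence the radius `R + 1` in the hypothesis. -/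
theorem fderiv_mollify {R : ℝ} {e : Space n} {u v : Space n → ℂ}
    (hu : LocallyIntegrable u) (huv : WeakDerivOnBall (R + 1) e u v) (k : ℕ) {x : Space n}
    (hx : x ∈ closedBall (0 : Space n) R) :
    fderiv ℝ (mollify k u) x e = mollify k v x := by
  set ρ := (shrinkingBump n k).normed (volume : Measure (Space n)) with hρ
  have hc : HasCompactSupport ρ := (shrinkingBump n k).hasCompactSupport_normed
  have hd : ContDiff ℝ ∞ ρ := (shrinkingBump n k).contDiff_normed
  have hd1 : ContDiff ℝ 1 ρ := (shrinkingBump n k).contDiff_normed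
  have h1 := (hc.hasFDerivAt_convolution_left (lsmul ℝ ℝ) hd1 hu x).fderiv
  have hint : Integrable (fun t => ((lsmul ℝ ℝ : ℝ →L[ℝ] ℂ →L[ℝ] ℂ).precompL (Space n))
      (fderiv ℝ ρ (x - t)) (u t)) := by
    have := (hc.fderiv ℝ).convolutionExists_left
      ((lsmul ℝ ℝ : ℝ →L[ℝ] ℂ →L[ℝ] ℂ).precompL (Space n))
      (hd1.continuous_fderiv one_ne_zero) hu x
    exact this.integrable_swap
  change fderiv ℝ (ρ ⋆[lsmul ℝ ℝ, volume] u) x e = (ρ ⋆[lsmul ℝ ℝ, volume] v) x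
  rw [h1, convolution_eq_swap, convolution_lsmul_swap, ContinuousLinearMap.integral_apply hint]
  have hψ : ContDiff ℝ ∞ (fun t => ρ (x - t)) := hd.comp (contDiff_const.sub contDiff_id)
  have hsupp : tsupport (fun t => ρ (x - t)) ⊆ closedBall (0 : Space n) (R + 1) := by
    refine closure_minimal (fun t ht => ?_) isClosed_closedBall
    have h2 : x - t ∈ Function.support ρ := ht
    rw [hρ, ContDiffBump.support_normed_eq, mem_ball_zero_iff] at h2
    rw [mem_closedBall_zero_iff] at hx ⊢
    have h3 := norm_sub_norm_le t x
    rw [norm_sub_rev] at h3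
    linarith [shrinkingBump_rOut_le (n := n) k]
  have h4 := huv _ hψ hsupp
  rw [← neg_eq_iff_eq_neg, ← integral_neg] at h4
  rw [← h4]
  refine integral_congr_ae (ae_of_all _ fun t => ?_)
  have h5 : HasFDerivAt (fun t => ρ (x - t)) (-(fderiv ℝ ρ (x - t))) t := by
    have := ((hd1.differentiable one_ne_zero (x - t)).hasFDerivAt).comp t
      ((hasFDerivAt_id t).const_sub x)
    refine this.congr_fderiv ?_
    ext y
    simp
  simp [h5.fderiv, ContinuousLinearMap.precompL_apply]

theorem integral_fderiv_smul_comp {F : ℂ → ℝ} (hF : ContDiff ℝ 1 F) {φ : Space n → ℝ}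
    (hφ : ContDiff ℝ ∞ φ) (hφc : HasCompactSupport φ) (e : Space n) {w : Space n → ℂ}
    (hw : ContDiff ℝ 1 w) :
    ∫ x, fderiv ℝ φ x e * F (w x) = -∫ x, φ x * fderiv ℝ F (w x) (fderiv ℝ w x e) := by
  have hFw : ContDiff ℝ 1 (fun x => F (w x)) := hF.comp hw
  have hφ1 : ContDiff ℝ 1 φ := hφ.of_le (by exact_mod_cast le_top)
  have hder : ∀ x, fderiv ℝ (fun x => F (w x)) x e = fderiv ℝ F (w x) (fderiv ℝ w x e) := by
    intro x
    have := ((hF.differentiable one_ne_zero (w x)).hasFDerivAt).comp x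
      ((hw.differentiable one_ne_zero x).hasFDerivAt)
    exact DFunLike.congr_fun this.fderiv e
  have hcφ' : HasCompactSupport (fun x => fderiv ℝ φ x e) := by
    exact (hφc.fderiv ℝ).comp_left (g := fun L : Space n →L[ℝ] ℝ => L e) (by simp)
  have hcont' : Continuous fun x => fderiv ℝ φ x e :=
    (hφ1.continuous_fderiv one_ne_zero).clm_apply continuous_const
  have hcontF : Continuous fun x => fderiv ℝ (fun x => F (w x)) x e :=
    (hFw.continuous_fderiv one_ne_zero).clm_apply continuous_const
  have h := integral_mul_fderiv_eq_neg_fderiv_mul_of_integrable (μ := volume) (v := e)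
    (f := fun x => F (w x)) (g := φ)
    ((hcontF.mul hφ.continuous).integrable_of_hasCompactSupport hφc.mul_left)
    ((hFw.continuous.mul hcont').integrable_of_hasCompactSupport hcφ'.mul_left)
    ((hFw.continuous.mul hφ.continuous).integrable_of_hasCompactSupport hφc.mul_left)
    (fun x _ => hFw.differentiable one_ne_zero x) (fun x _ => hφ1.differentiable one_ne_zero x)
  simp_rw [mul_comm (fderiv ℝ φ _ e), h, hder, mul_comm (φ _)]

end EMNLS

/-! ### Chain rule for weak derivatives. -/

namespace EMNLS

open Filter Topology Metric

theorem tendsto_integral_of_tendsto_integral_norm_sub {α F : Type*} [MeasurableSpace α]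
    {μ : Measure α} [NormedAddCommGroup F] [NormedSpace ℝ F] {f : ℕ → α → F} {g : α → F}
    (hf : ∀ k, Integrable (f k) μ) (hg : Integrable g μ)
    (h : Tendsto (fun k => ∫ x, ‖f k x - g x‖ ∂μ) atTop (𝓝 0)) :
    Tendsto (fun k => ∫ x, f k x ∂μ) atTop (𝓝 (∫ x, g x ∂μ)) := by
  rw [tendsto_iff_norm_sub_tendsto_zero]
  refine squeeze_zero (fun k => norm_nonneg _) (fun k => ?_) h
  rw [← integral_sub (hf k) hg]
  exact norm_integral_le_integral_norm _

variable {n : ℕ}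

theorem hasCompactSupport_of_tsupport_subset_closedBall {R : ℝ} {φ : Space n → ℝ}
    (h : tsupport φ ⊆ closedBall 0 R) : HasCompactSupport φ :=
  (isCompact_closedBall 0 R).of_isClosed_subset (isClosed_tsupport φ) h

theorem hasCompactSupport_fderiv_apply {φ : Space n → ℝ} (h : HasCompactSupport φ)
    (e : Space n) : HasCompactSupport (fun x => fderiv ℝ φ x e) :=
  (h.fderiv ℝ).comp_left (g := fun L : Space n →L[ℝ] ℝ => L e) (by simp)

theorem continuous_fderiv_apply {φ : Space n → ℝ} (h : ContDiff ℝ ∞ φ) (e : Space n) :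
    Continuous fun x => fderiv ℝ φ x e :=
  (h.continuous_fderiv (by simp)).clm_apply continuous_const

/-- A locally integrable function times a continuous compactly supported one is integrable. -/
theorem integrable_mul_of_locallyIntegrable {ψ f : Space n → ℝ} (hψ : Continuous ψ)
    (hc : HasCompactSupport ψ) (hf : LocallyIntegrable f) : Integrable fun x => ψ x * f x :=
  hf.integrable_smul_left_of_hasCompactSupport hψ hc

/-- The chain rule for weak derivatives, tested against a function supported in a ball. -/
theorem WeakDerivOnBall.integral_comp {R : ℝ} {e : Space n} {u v : Space n → ℂ}
    (huv : WeakDerivOnBall (R + 1) e u v) (hu : Integrable u) (hv : Integrable v)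
    {F : ℂ → ℝ} (hF : ContDiff ℝ 1 F) {C : ℝ} (hC : ∀ z, ‖fderiv ℝ F z‖ ≤ C)
    {φ : Space n → ℝ} (hφ : ContDiff ℝ ∞ φ) (hsupp : tsupport φ ⊆ closedBall 0 R) :
    ∫ x, fderiv ℝ φ x e * F (u x) = -∫ x, φ x * fderiv ℝ F (u x) (v x) := by
  have hC0 : 0 ≤ C := (norm_nonneg _).trans (hC 0)
  have hφc : HasCompactSupport φ := hasCompactSupport_of_tsupport_subset_closedBall hsupp
  have hcφ' := hasCompactSupport_fderiv_apply hφc e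
  have hcont' := continuous_fderiv_apply hφ e
  obtain ⟨M, hM⟩ := hφc.exists_bound_of_continuous hφ.continuous
  obtain ⟨M', hM'⟩ := hcφ'.exists_bound_of_continuous hcont'
  have hM0 : 0 ≤ M := (norm_nonneg _).trans (hM 0)
  have hM0' : 0 ≤ M' := (norm_nonneg _).trans (hM' 0)
  have hlip : ∀ z w, ‖F z - F w‖ ≤ C * ‖z - w‖ := fun z w =>
    convex_univ.norm_image_sub_le_of_norm_fderiv_le (𝕜 := ℝ)
      (fun x _ => hF.differentiable one_ne_zero x) (fun x _ => hC x) (mem_univ w) (mem_univ z)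
  have hlocF : ∀ {w : Space n → ℂ}, Integrable w → LocallyIntegrable fun x => F (w x) := by
    intro w hw
    have h1 : LocallyIntegrable (fun x => ‖F 0‖ + C * ‖w x‖) :=
      (locallyIntegrable_const _).add (hw.norm.const_mul C).locallyIntegrable
    refine h1.mono (hF.continuous.comp_aestronglyMeasurable hw.aestronglyMeasurable)
      (ae_of_all _ fun x => ?_)
    have h2 := hlip (w x) 0
    have h3 := norm_sub_norm_le (F (w x)) (F 0)
    rw [sub_zero] at h2
    refine le_trans ?_ (le_abs_self _)
    linarith
  have hF' : Continuous fun z => fderiv ℝ F z := hF.continuous_fderiv one_ne_zero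
  have hintR : ∀ {w z : Space n → ℂ}, Integrable w → Integrable z →
      Integrable fun x => φ x * fderiv ℝ F (w x) (z x) := by
    intro w z hw hz
    have hm : AEStronglyMeasurable (fun x => fderiv ℝ F (w x) (z x)) volume :=
      (isBoundedBilinearMap_apply (𝕜 := ℝ) (E := ℂ) (F := ℝ)).continuous.comp_aestronglyMeasurable₂
        (hF'.comp_aestronglyMeasurable hw.aestronglyMeasurable) hz.aestronglyMeasurable
    refine (hz.norm.const_mul (M * C)).mono' (hφ.continuous.aestronglyMeasurable.mul hm)
      (ae_of_all _ fun x => ?_)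
    rw [norm_mul, mul_assoc]
    exact mul_le_mul (hM x) (((fderiv ℝ F (w x)).le_opNorm _).trans
      (mul_le_mul_of_nonneg_right (hC _) (norm_nonneg _))) (norm_nonneg _) hM0
  have hL : Tendsto (fun k => ∫ x, fderiv ℝ φ x e * F (mollify k u x)) atTop
      (𝓝 (∫ x, fderiv ℝ φ x e * F (u x))) := by
    have hint : ∀ {w : Space n → ℂ}, Integrable w →
        Integrable fun x => fderiv ℝ φ x e * F (w x) := fun hw =>
      integrable_mul_of_locallyIntegrable hcont' hcφ' (hlocF hw)
    refine tendsto_integral_of_tendsto_integral_norm_sub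
      (fun k => hint (integrable_mollify k hu)) (hint hu) ?_
    have h1 := (tendsto_integral_norm_mollify_sub hu).const_mul (M' * C)
    rw [mul_zero] at h1
    refine squeeze_zero (fun k => integral_nonneg fun x => norm_nonneg _) (fun k => ?_) h1
    rw [← integral_const_mul]
    refine integral_mono ((hint (integrable_mollify k hu)).sub (hint hu)).norm
      (((integrable_mollify k hu).sub hu).norm.const_mul _) fun x => ?_
    simp only
    rw [← mul_sub, norm_mul, mul_assoc]
    exact mul_le_mul (hM' x) (hlip _ _) (norm_nonneg _) hM0'
  have hR : Tendsto (fun k => ∫ x, φ x * fderiv ℝ F (mollify k u x) (mollify k v x)) atTop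
      (𝓝 (∫ x, φ x * fderiv ℝ F (u x) (v x))) := by
    -- The two mollifications are removed separately: with `v` fixed, dominated convergence handles
    -- the point at which `F'` is taken; then `F'` being bounded reduces the rest to `L¹`
    -- convergence of `mollify k v`.
    have hA : Tendsto (fun k => ∫ x, φ x * fderiv ℝ F (mollify k u x) (v x)) atTop
        (𝓝 (∫ x, φ x * fderiv ℝ F (u x) (v x))) := by
      refine tendsto_integral_of_dominated_convergence (fun x => M * C * ‖v x‖)
        (fun k => (hintR (integrable_mollify k hu) hv).aestronglyMeasurable)
        (hv.norm.const_mul _) (fun k => ae_of_all _ fun x => ?_) ?_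
      · rw [norm_mul, mul_assoc]
        exact mul_le_mul (hM x) (((fderiv ℝ F _).le_opNorm _).trans
          (mul_le_mul_of_nonneg_right (hC _) (norm_nonneg _))) (norm_nonneg _) hM0
      · filter_upwards [ae_tendsto_mollify hu.locallyIntegrable] with x hx
        exact (((hF'.clm_apply (continuous_const (y := v x))).tendsto (u x)).comp hx).const_mul _
    have hB : Tendsto (fun k => ∫ x, (φ x * fderiv ℝ F (mollify k u x) (mollify k v x) -
        φ x * fderiv ℝ F (mollify k u x) (v x))) atTop (𝓝 0) := by
      have h1 := (tendsto_integral_norm_mollify_sub hv).const_mul (M * C)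
      rw [mul_zero] at h1
      refine squeeze_zero_norm (fun k => ?_) h1
      rw [← integral_const_mul]
      refine norm_integral_le_of_norm_le (((integrable_mollify k hv).sub hv).norm.const_mul _)
        (ae_of_all _ fun x => ?_)
      rw [← mul_sub, norm_mul, mul_assoc, ← map_sub]
      exact mul_le_mul (hM x) (((fderiv ℝ F _).le_opNorm _).trans
        (mul_le_mul_of_nonneg_right (hC _) (norm_nonneg _))) (norm_nonneg _) hM0
    have := hB.add hA
    rw [zero_add] at this
    refine this.congr fun k => ?_
    rw [integral_sub (hintR (integrable_mollify k hu) (integrable_mollify k hv))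
      (hintR (integrable_mollify k hu) hv), sub_add_cancel]
  refine tendsto_nhds_unique hL (hR.neg.congr fun k => ?_)
  rw [integral_fderiv_smul_comp hF hφ hφc e (contDiff_mollify k hu.locallyIntegrable)]
  congr 1
  refine integral_congr_ae (ae_of_all _ fun x => ?_)
  by_cases hx : x ∈ closedBall (0 : Space n) R
  · simp only [fderiv_mollify hu.locallyIntegrable huv k hx]
  · simp [image_eq_zero_of_notMem_tsupport fun h => hx (hsupp h)]

end EMNLS

/-! ### Weak gradient of the modulus and the diamagnetic inequality. -/

namespace EMNLS

open Filter Topology Metric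

/-- A smooth approximation of the modulus on `ℂ`. -/
noncomputable def smoothAbs (ε : ℝ) (z : ℂ) : ℝ := √(‖z‖ ^ 2 + ε ^ 2)

theorem contDiff_smoothAbs {ε : ℝ} (hε : 0 < ε) : ContDiff ℝ 1 (smoothAbs ε) :=
  ((contDiff_norm_sq ℝ).add contDiff_const).sqrt fun z => by positivity

theorem fderiv_smoothAbs {ε : ℝ} (hε : 0 < ε) (z w : ℂ) :
    fderiv ℝ (smoothAbs ε) z w = inner ℝ z w / smoothAbs ε z := by
  have h1 := ((hasStrictFDerivAt_norm_sq z).hasFDerivAt.add_const (ε ^ 2)).sqrt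
    (by positivity : ‖z‖ ^ 2 + ε ^ 2 ≠ 0)
  have h2 : fderiv ℝ (smoothAbs ε) z = _ := h1.fderiv
  rw [h2]
  have h3 : smoothAbs ε z ≠ 0 := (Real.sqrt_pos.2 (by positivity)).ne'
  simp only [_root_.smul_apply, innerSL_apply_apply, smul_eq_mul, nsmul_eq_mul]
  change 1 / (2 * smoothAbs ε z) * _ = _
  field_simp
  simp

theorem norm_le_smoothAbs (ε : ℝ) (z : ℂ) : ‖z‖ ≤ smoothAbs ε z :=
  Real.le_sqrt_of_sq_le (by nlinarith [sq_nonneg ε])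

theorem norm_fderiv_smoothAbs_le {ε : ℝ} (hε : 0 < ε) (z : ℂ) :
    ‖fderiv ℝ (smoothAbs ε) z‖ ≤ 1 := by
  refine ContinuousLinearMap.opNorm_le_bound _ zero_le_one fun w => ?_
  have h3 : 0 < smoothAbs ε z := Real.sqrt_pos.2 (by positivity)
  rw [fderiv_smoothAbs hε, norm_div, Real.norm_of_nonneg h3.le, div_le_iff₀ h3, one_mul]
  refine (norm_inner_le_norm z w).trans ?_
  rw [mul_comm]
  exact mul_le_mul_of_nonneg_left (norm_le_smoothAbs ε z) (norm_nonneg w)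

theorem tendsto_smoothAbs (z : ℂ) :
    Tendsto (fun k : ℕ => smoothAbs (1 / ((k : ℝ) + 1)) z) atTop (𝓝 ‖z‖) := by
  have h : Continuous fun ε : ℝ => smoothAbs ε z := by
    unfold smoothAbs
    fun_prop
  have h1 := (h.tendsto 0).comp (tendsto_one_div_add_atTop_nhds_zero_nat (𝕜 := ℝ))
  simpa [smoothAbs, Function.comp_def] using h1

variable {n : ℕ}

/-- The modulus is not differentiable at 0, so the chain rule is used for `√(|z|² + ε²)`, whose
derivative is bounded by 1 uniformly in `ε`, and `ε → 0` by dominated convergence. -/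
theorem WeakDerivOnBall.integral_norm {R : ℝ} {e : Space n} {u v : Space n → ℂ}
    (huv : WeakDerivOnBall (R + 1) e u v) (hu : Integrable u) (hv : Integrable v)
    {φ : Space n → ℝ} (hφ : ContDiff ℝ ∞ φ) (hsupp : tsupport φ ⊆ closedBall 0 R) :
    ∫ x, fderiv ℝ φ x e * ‖u x‖ = -∫ x, φ x * (inner ℝ (u x) (v x) / ‖u x‖) := by
  have hφc : HasCompactSupport φ := hasCompactSupport_of_tsupport_subset_closedBall hsupp
  have hcφ' := hasCompactSupport_fderiv_apply hφc e
  have hcont' := continuous_fderiv_apply hφ e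
  obtain ⟨M, hM⟩ := hφc.exists_bound_of_continuous hφ.continuous
  have hM0 : 0 ≤ M := (norm_nonneg _).trans (hM 0)
  have hε : ∀ k : ℕ, (0 : ℝ) < 1 / ((k : ℝ) + 1) := fun k => by positivity
  have hε1 : ∀ k : ℕ, 1 / ((k : ℝ) + 1) ≤ 1 := fun k => by
    rw [div_le_one (by positivity)]
    linarith [(Nat.cast_nonneg k : (0 : ℝ) ≤ k)]
  have hle : ∀ (k : ℕ) (z : ℂ), smoothAbs (1 / ((k : ℝ) + 1)) z ≤ ‖z‖ + 1 := fun k z => by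
    refine Real.sqrt_le_iff.2 ⟨by positivity, ?_⟩
    nlinarith [hε k, hε1 k, norm_nonneg z]
  have hL : Tendsto (fun k : ℕ => ∫ x, fderiv ℝ φ x e * smoothAbs (1 / ((k : ℝ) + 1)) (u x))
      atTop (𝓝 (∫ x, fderiv ℝ φ x e * ‖u x‖)) := by
    refine tendsto_integral_of_dominated_convergence
      (fun x => |fderiv ℝ φ x e| * (‖u x‖ + 1))
      (fun k => hcont'.aestronglyMeasurable.mul
        ((contDiff_smoothAbs (hε k)).continuous.comp_aestronglyMeasurable hu.aestronglyMeasurable))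
      (integrable_mul_of_locallyIntegrable hcont'.abs hcφ'.abs
        (hu.norm.locallyIntegrable.add (locallyIntegrable_const 1)))
      (fun k => ae_of_all _ fun x => ?_)
      (ae_of_all _ fun x => (tendsto_smoothAbs (u x)).const_mul _)
    rw [norm_mul, Real.norm_eq_abs,
      Real.norm_of_nonneg ((norm_nonneg _).trans (norm_le_smoothAbs _ (u x)))]
    exact mul_le_mul_of_nonneg_left (hle k _) (abs_nonneg _)
  have hR : Tendsto (fun k : ℕ => ∫ x, φ x *
      fderiv ℝ (smoothAbs (1 / ((k : ℝ) + 1))) (u x) (v x))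
      atTop (𝓝 (∫ x, φ x * (inner ℝ (u x) (v x) / ‖u x‖))) := by
    refine tendsto_integral_of_dominated_convergence (fun x => M * ‖v x‖) (fun k => ?_)
      (hv.norm.const_mul _) (fun k => ae_of_all _ fun x => ?_) (ae_of_all _ fun x => ?_)
    · refine hφ.continuous.aestronglyMeasurable.mul ?_
      exact (isBoundedBilinearMap_apply (𝕜 := ℝ) (E := ℂ)
        (F := ℝ)).continuous.comp_aestronglyMeasurable₂
        (((contDiff_smoothAbs (hε k)).continuous_fderiv one_ne_zero).comp_aestronglyMeasurable
          hu.aestronglyMeasurable) hv.aestronglyMeasurable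
    · rw [norm_mul]
      refine mul_le_mul (hM x) (((fderiv ℝ _ _).le_opNorm _).trans ?_) (norm_nonneg _) hM0
      exact mul_le_of_le_one_left (norm_nonneg _) (norm_fderiv_smoothAbs_le (hε k) _)
    · refine Tendsto.const_mul _ ?_
      simp_rw [fderiv_smoothAbs (hε _)]
      -- At zeros of `u` the regularized derivative is 0, which agrees with the convention `0 / 0 =
      -- 0` in the limit.
      by_cases hx : u x = 0
      · simp [hx]
      · exact tendsto_const_nhds.div (tendsto_smoothAbs (u x)) (norm_ne_zero_iff.2 hx)
  refine tendsto_nhds_unique hL (hR.neg.congr fun k => ?_)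
  exact (huv.integral_comp hu hv (contDiff_smoothAbs (hε k))
    (norm_fderiv_smoothAbs_le (hε k)) hφ hsupp).symm

/-- The gradient of `|u|`, expressed through the gradient `g` of `u`. -/
noncomputable def modulusGrad (u : Space n → ℂ) (g : Space n → CVec n) : Space n → CVec n :=
  fun x => WithLp.toLp 2 fun j => ((inner ℝ (u x) (g x j) / ‖u x‖ : ℝ) : ℂ)

/-- The vector `i Aⱼ u` is orthogonal to `u` in the real inner product of `ℂ`, so the potential can
be added inside the inner product at no cost; Cauchy–Schwarz finishes each component. -/
theorem norm_modulusGrad_le (A : Space n → Space n) (u : Space n → ℂ) (g : Space n → CVec n)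
    (x : Space n) : ‖modulusGrad u g x‖ ≤ ‖covariant A u g x‖ := by
  rw [EuclideanSpace.norm_eq, EuclideanSpace.norm_eq]
  refine Real.sqrt_le_sqrt (Finset.sum_le_sum fun j _ => pow_le_pow_left₀ (norm_nonneg _) ?_ 2)
  change ‖((inner ℝ (u x) (g x j) / ‖u x‖ : ℝ) : ℂ)‖ ≤ ‖g x j + Complex.I * (A x j : ℂ) * u x‖
  have h : inner ℝ (u x) (g x j + Complex.I * (A x j : ℂ) * u x) =
      (inner ℝ (u x) (g x j) : ℝ) := by
    rw [inner_add_right (𝕜 := ℝ) (E := ℂ)]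
    simp [Complex.inner]
    ring
  rw [Complex.norm_real, norm_div, norm_norm, ← h]
  refine div_le_of_le_mul₀ (norm_nonneg _) (norm_nonneg _) ?_
  exact (norm_inner_le_norm (𝕜 := ℝ) (u x) (g x j + Complex.I * (A x j : ℂ) * u x)).trans_eq
    (mul_comm _ _)

theorem covariant_zero (u : Space n → ℂ) (g : Space n → CVec n) :
    covariant (fun _ => 0) u g = g := by
  ext x j
  simp [covariant]

theorem aestronglyMeasurable_apply {g : Space n → CVec n} (hg : AEStronglyMeasurable g volume)
    (j : Fin n) : AEStronglyMeasurable (fun x => g x j) volume :=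
  (EuclideanSpace.proj (𝕜 := ℂ) j).continuous.comp_aestronglyMeasurable hg

theorem locallyIntegrable_apply {g : Space n → CVec n} (hg : LocallyIntegrable g)
    (j : Fin n) : LocallyIntegrable (fun x => g x j) :=
  hg.mono (aestronglyMeasurable_apply hg.aestronglyMeasurable j)
    (ae_of_all _ fun x => PiLp.norm_apply_le (g x) j)

theorem aestronglyMeasurable_modulusGrad {u : Space n → ℂ} {g : Space n → CVec n}
    (hu : AEStronglyMeasurable u volume) (hg : AEStronglyMeasurable g volume) :
    AEStronglyMeasurable (modulusGrad u g) volume := by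
  have h : AEMeasurable (fun x => fun j => ((inner ℝ (u x) (g x j) / ‖u x‖ : ℝ) : ℂ)) volume := by
    refine aemeasurable_pi_lambda _ fun j => ?_
    exact Complex.measurable_ofReal.comp_aemeasurable
      ((hu.inner (aestronglyMeasurable_apply hg j)).aemeasurable.div hu.norm.aemeasurable)
  exact (PiLp.continuous_toLp 2 _).comp_aestronglyMeasurable h.aestronglyMeasurable

theorem HasWeakGrad.modulus {u : Space n → ℂ} {g : Space n → CVec n} (h : HasWeakGrad u g) :
    HasWeakGrad (modulus u) (modulusGrad u g) := by
  obtain ⟨hu, hg, hug⟩ := h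
  refine ⟨hu.mono (Complex.continuous_ofReal.comp_aestronglyMeasurable
      hu.aestronglyMeasurable.norm) (ae_of_all _ fun x => by simp [EMNLS.modulus]),
    hg.mono (aestronglyMeasurable_modulusGrad hu.aestronglyMeasurable hg.aestronglyMeasurable)
      (ae_of_all _ fun x => ?_), fun φ hφ hφc j => ?_⟩
  · have := norm_modulusGrad_le (fun _ => 0) u g x
    rwa [covariant_zero] at this
  · obtain ⟨R, hR⟩ := hφc.isCompact.isBounded.subset_closedBall 0
    -- Truncation to `B` makes `u` and its gradient integrable and leaves all integrals against test
    -- functions supported in `B` unchanged. The margin 1 is consumed by mollification.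
    set B := closedBall (0 : Space n) (R + 1)
    have hBm : MeasurableSet B := isClosed_closedBall.measurableSet
    have hBc : IsCompact B := isCompact_closedBall _ _
    have hu1 : Integrable (B.indicator u) :=
      (integrable_indicator_iff hBm).2 (hu.integrableOn_isCompact hBc)
    have hv1 : Integrable (B.indicator fun x => g x j) :=
      (integrable_indicator_iff hBm).2 ((locallyIntegrable_apply hg j).integrableOn_isCompact hBc)
    have hzero : ∀ {ψ : Space n → ℝ} {r : ℝ}, tsupport ψ ⊆ closedBall 0 r → r ≤ R + 1 →
        ∀ x, x ∉ B → ψ x = 0 ∧ fderiv ℝ ψ x (EuclideanSpace.single j 1) = 0 := by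
      intro ψ r hψ hr x hx
      have hx' : x ∉ tsupport ψ := fun h => hx (closedBall_subset_closedBall hr (hψ h))
      refine ⟨image_eq_zero_of_notMem_tsupport hx', ?_⟩
      have : x ∉ tsupport (fderiv ℝ ψ) := fun h => hx' (tsupport_fderiv_subset ℝ h)
      simp [image_eq_zero_of_notMem_tsupport this]
    have hw : WeakDerivOnBall (R + 1) (EuclideanSpace.single j 1) (B.indicator u)
        (B.indicator fun x => g x j) := by
      intro ψ hψ hψs
      convert hug ψ hψ (hasCompactSupport_of_tsupport_subset_closedBall hψs) j using 2
      · ext x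
        by_cases hx : x ∈ B
        · simp [hx]
        · simp [hx, hzero hψs le_rfl x hx]
      · refine integral_congr_ae (ae_of_all _ fun x => ?_)
        by_cases hx : x ∈ B
        · simp [hx]
        · simp [hx, hzero hψs le_rfl x hx]
    have key := hw.integral_norm hu1 hv1 hφ hR
    have e1 : ∫ x, fderiv ℝ φ x (EuclideanSpace.single j 1) * ‖B.indicator u x‖ =
        ∫ x, fderiv ℝ φ x (EuclideanSpace.single j 1) * ‖u x‖ := by
      refine integral_congr_ae (ae_of_all _ fun x => ?_)
      by_cases hx : x ∈ B
      · simp [hx]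
      · simp [hx, hzero hR (by linarith) x hx]
    have e2 : ∫ x, φ x * (inner ℝ (B.indicator u x) (B.indicator (fun x => g x j) x) /
        ‖B.indicator u x‖) = ∫ x, φ x * (inner ℝ (u x) (g x j) / ‖u x‖) := by
      refine integral_congr_ae (ae_of_all _ fun x => ?_)
      by_cases hx : x ∈ B
      · simp [hx]
      · simp [hx, hzero hR (by linarith) x hx]
    rw [e1, e2] at key
    have key' := congrArg (fun r : ℝ => (r : ℂ)) key
    simp only [Complex.ofReal_neg, ← integral_complex_ofReal, Complex.ofReal_mul] at key'
    simpa only [EMNLS.modulus, modulusGrad, Complex.real_smul] using key'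

/-- The fundamental lemma of the calculus of variations, componentwise. It lets any explicit
gradient replace the one chosen by `weakGrad`. -/
theorem HasWeakGrad.ae_eq {u : Space n → ℂ} {g h : Space n → CVec n} (hg : HasWeakGrad u g)
    (hh : HasWeakGrad u h) : g =ᵐ[volume] h := by
  have key : ∀ᵐ x, ∀ j, g x j = h x j := by
    rw [ae_all_iff]
    intro j
    refine ae_eq_of_integral_contDiff_smul_eq (locallyIntegrable_apply hg.2.1 j)
      (locallyIntegrable_apply hh.2.1 j) fun φ hφ hφc => ?_
    have h1 := hg.2.2 φ hφ hφc j
    rw [hh.2.2 φ hφ hφc j] at h1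
    exact (neg_injective h1).symm
  filter_upwards [key] with x hx
  ext j
  exact hx j

theorem HasWeakGrad.hasWeakGrad_weakGrad {u : Space n → ℂ} {g : Space n → CVec n}
    (hg : HasWeakGrad u g) : HasWeakGrad u (weakGrad u) := by
  have h : ∃ g, HasWeakGrad u g := ⟨g, hg⟩
  rw [weakGrad, dif_pos h]
  exact h.choose_spec

theorem HasWeakGrad.weakGrad_ae_eq {u : Space n → ℂ} {g : Space n → CVec n}
    (hg : HasWeakGrad u g) : weakGrad u =ᵐ[volume] g :=
  hg.hasWeakGrad_weakGrad.ae_eq hg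

theorem HasWeakGrad.magGrad_ae_eq {u : Space n → ℂ} {g : Space n → CVec n}
    (hg : HasWeakGrad u g) (A : Space n → Space n) :
    magGrad A u =ᵐ[volume] covariant A u g := by
  filter_upwards [hg.weakGrad_ae_eq] with x hx
  simp only [magGrad, covariant, hx]

theorem memLp_modulus {u : Space n → ℂ} {q : ℝ≥0∞} (hu : MemLp u q volume) :
    MemLp (modulus u) q volume :=
  hu.norm.ofReal

theorem eLpNorm_modulus (u : Space n → ℂ) (q : ℝ≥0∞) :
    eLpNorm (modulus u) q volume = eLpNorm u q volume :=
  eLpNorm_congr_norm_ae (ae_of_all _ fun x => by simp [modulus])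

/-- The modulus of a function in `H¹_A` is in `H¹`. -/
theorem MemH1A.memH1_modulus {A : Space n → Space n} {u : Space n → ℂ} (hu : MemH1A A u) :
    MemH1 (modulus u) := by
  obtain ⟨hu2, g, hg, hA⟩ := hu
  exact ⟨memLp_modulus hu2, modulusGrad u g, hg.modulus, hA.mono
    (aestronglyMeasurable_modulusGrad hu2.1 hg.2.1.aestronglyMeasurable)
    (ae_of_all _ (norm_modulusGrad_le A u g))⟩

/-- The diamagnetic inequality in `L²`. -/
theorem MemH1A.nrm_weakGrad_modulus_le {A : Space n → Space n} {u : Space n → ℂ}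
    (hu : MemH1A A u) : nrm 2 (weakGrad (modulus u)) ≤ nrm 2 (magGrad A u) := by
  obtain ⟨hu2, g, hg, hA⟩ := hu
  unfold nrm
  rw [eLpNorm_congr_ae hg.modulus.weakGrad_ae_eq, eLpNorm_congr_ae (hg.magGrad_ae_eq A)]
  refine ENNReal.toReal_mono ?_ (eLpNorm_mono (norm_modulusGrad_le A u g))
  rw [ENNReal.ofReal_ofNat]
  exact hA.eLpNorm_ne_top

end EMNLS

/-! ### Norms and weak gradients under dilation. -/

namespace EMNLS

open Filter Topology Metric

variable {n : ℕ}

theorem eLpNorm_comp_smul {F : Type*} [NormedAddCommGroup F] {a : ℝ} (ha : 0 < a)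
    {q : ℝ≥0∞} (hq : q ≠ ⊤) (f : Space n → F) :
    eLpNorm (fun x => f (a • x)) q volume =
      ENNReal.ofReal (a ^ n)⁻¹ ^ (1 / q).toReal * eLpNorm f q volume := by
  have h1 := ((Homeomorph.smulOfNeZero a ha.ne').measurableEmbedding).eLpNorm_map_measure
    (μ := (volume : Measure (Space n))) (p := q) (g := f)
  have h2 : Measure.map (Homeomorph.smulOfNeZero a ha.ne') (volume : Measure (Space n)) =
      ENNReal.ofReal (a ^ n)⁻¹ • volume := by
    have := Measure.map_addHaar_smul (volume : Measure (Space n)) ha.ne'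
    rw [finrank_euclideanSpace_fin, abs_of_pos (by positivity)] at this
    exact this
  rw [h2, eLpNorm_smul_measure_of_ne_top hq, smul_eq_mul] at h1
  exact h1.symm

theorem nrm_nonneg {F : Type} [NormedAddCommGroup F] (q : ℝ) (f : Space n → F) :
    0 ≤ nrm q f :=
  ENNReal.toReal_nonneg

theorem nrm_comp_smul {F : Type} [NormedAddCommGroup F] {a q : ℝ} (ha : 0 < a) (hq : 0 < q)
    (f : Space n → F) : nrm q (fun x => f (a • x)) = a ^ (-((n : ℝ) / q)) * nrm q f := by
  unfold nrm
  rw [eLpNorm_comp_smul ha ENNReal.ofReal_ne_top, ENNReal.toReal_mul, ← ENNReal.toReal_rpow,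
    ENNReal.toReal_ofReal (by positivity), ENNReal.toReal_div, ENNReal.toReal_one,
    ENNReal.toReal_ofReal hq.le, ← Real.rpow_natCast, ← Real.rpow_neg ha.le,
    ← Real.rpow_mul ha.le]
  congr 2
  ring

theorem nrm_const_smul {F : Type} [NormedAddCommGroup F] [NormedSpace ℂ F] (q : ℝ) (c : ℂ)
    (f : Space n → F) : nrm q (fun x => c • f x) = ‖c‖ * nrm q f := by
  unfold nrm
  rw [show (fun x => c • f x) = c • f from rfl, eLpNorm_const_smul, ENNReal.toReal_mul,
    toReal_enorm]

theorem locallyIntegrable_comp_smul {F : Type*} [NormedAddCommGroup F] {a : ℝ} (ha : 0 < a)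
    {f : Space n → F} (hf : LocallyIntegrable f) :
    LocallyIntegrable fun x => f (a • x) := by
  refine (locallyIntegrable_map_homeomorph (Homeomorph.smulOfNeZero a ha.ne')).1 ?_
  have h2 : Measure.map (Homeomorph.smulOfNeZero a ha.ne') (volume : Measure (Space n)) =
      ENNReal.ofReal |(a ^ Module.finrank ℝ (Space n))⁻¹| • volume :=
    Measure.map_addHaar_smul (volume : Measure (Space n)) ha.ne'
  rw [h2]
  intro x
  obtain ⟨s, hs, hi⟩ := hf x
  refine ⟨s, hs, ?_⟩
  rw [IntegrableOn, Measure.restrict_smul]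
  exact hi.smul_measure ENNReal.ofReal_ne_top

/-- The weak gradient of `c u(a ·)` is `c a (∇u)(a ·)`. -/
theorem HasWeakGrad.const_mul_comp_smul {u : Space n → ℂ} {g : Space n → CVec n}
    (h : HasWeakGrad u g) (c : ℂ) {a : ℝ} (ha : 0 < a) :
    HasWeakGrad (fun x => c * u (a • x)) (fun x => (c * a) • g (a • x)) := by
  obtain ⟨hu, hg, hug⟩ := h
  refine ⟨(locallyIntegrable_comp_smul ha hu).smul c,
    (locallyIntegrable_comp_smul ha hg).smul (c * (a : ℂ)), fun φ hφ hφc j => ?_⟩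
  -- The dilation is moved to the test function; the Jacobians on both sides agree, and
  -- differentiating `ψ` produces the factor `a`.
  set ψ : Space n → ℝ := fun y => φ (a⁻¹ • y) with hψ
  have hψd : ContDiff ℝ ∞ ψ := hφ.comp (contDiff_const_smul _)
  have hψc : HasCompactSupport ψ :=
    hφc.comp_homeomorph (Homeomorph.smulOfNeZero a⁻¹ (by positivity))
  have hd : ∀ y e, fderiv ℝ ψ y e = a⁻¹ * fderiv ℝ φ (a⁻¹ • y) e := by
    intro y e
    have h1 := ((hφ.differentiable (by simp) (a⁻¹ • y)).hasFDerivAt).comp y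
      ((hasFDerivAt_id y).const_smul a⁻¹)
    have h2 : fderiv ℝ ψ y = _ := h1.fderiv
    rw [h2]
    simp
  have key := hug ψ hψd hψc j
  have e1 := Measure.integral_comp_smul (volume : Measure (Space n))
    (fun y => (fderiv ℝ ψ y (EuclideanSpace.single j 1)) • u y) a
  have e2 := Measure.integral_comp_smul (volume : Measure (Space n)) (fun y => ψ y • g y j) a
  rw [key, smul_neg, ← e2] at e1
  have f1 : ∫ x, (fderiv ℝ φ x (EuclideanSpace.single j 1)) • (c * u (a • x)) =
      c * a * ∫ x, (fderiv ℝ ψ (a • x) (EuclideanSpace.single j 1)) • u (a • x) := by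
    rw [← integral_const_mul]
    refine integral_congr_ae (ae_of_all _ fun x => ?_)
    simp only [hd, smul_smul, inv_mul_cancel₀ ha.ne', one_smul, Complex.real_smul,
      Complex.ofReal_mul, Complex.ofReal_inv]
    have : (a : ℂ) ≠ 0 := by exact_mod_cast ha.ne'
    field_simp
  have f2 : ∫ x, φ x • ((c * (a : ℂ)) • g (a • x)) j =
      c * a * ∫ x, ψ (a • x) • g (a • x) j := by
    rw [← integral_const_mul]
    refine integral_congr_ae (ae_of_all _ fun x => ?_)
    simp only [hψ, smul_smul, inv_mul_cancel₀ ha.ne', one_smul, Complex.real_smul,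
      PiLp.smul_apply, smul_eq_mul]
    ring
  rw [f1, f2, e1, mul_neg]

/-! ### The soliton and the sharp Gagliardo–Nirenberg inequality. -/

section GroundState

variable {p : ℝ} {Q : Space n → ℝ}

theorem norm_soliton_phase (l t : ℝ) :
    ‖Complex.exp (Complex.I * (l : ℂ) * (t : ℂ))‖ = 1 := by
  rw [mul_assoc, ← Complex.ofReal_mul, mul_comm, Complex.norm_exp_ofReal_mul_I]

theorem nrm_soliton {q : ℝ} (hq : 0 < q) (ha : 0 < √((n : ℝ) * (p - 1)) / 2) (t : ℝ) :
    nrm q (soliton p Q t) =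
      (√((n : ℝ) * (p - 1)) / 2) ^ (-((n : ℝ) / q)) * nrm q (fun x => (Q x : ℂ)) := by
  have h := nrm_const_smul q (Complex.exp (Complex.I *
    ((1 - ((n : ℝ) - 2) * (p - 1) / 4 : ℝ) : ℂ) * (t : ℂ)))
    (fun x => (Q ((√((n : ℝ) * (p - 1)) / 2) • x) : ℂ))
  rw [norm_soliton_phase, one_mul, nrm_comp_smul ha hq (fun x => (Q x : ℂ))] at h
  exact h

theorem nrm_weakGrad_soliton (hQ : MemH1 fun x => (Q x : ℂ))
    (ha : 0 < √((n : ℝ) * (p - 1)) / 2) (t : ℝ) :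
    nrm 2 (weakGrad (soliton p Q t)) =
      (√((n : ℝ) * (p - 1)) / 2) ^ (1 - (n : ℝ) / 2) *
        nrm 2 (weakGrad fun x => (Q x : ℂ)) := by
  obtain ⟨-, g, hg, -⟩ := hQ
  have h1 := hg.hasWeakGrad_weakGrad.const_mul_comp_smul (Complex.exp (Complex.I *
    ((1 - ((n : ℝ) - 2) * (p - 1) / 4 : ℝ) : ℂ) * (t : ℂ))) ha
  have h2 : nrm 2 (weakGrad (soliton p Q t)) = _ :=
    congrArg ENNReal.toReal (eLpNorm_congr_ae h1.weakGrad_ae_eq)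
  rw [h2]
  refine (nrm_const_smul 2 _ _).trans ?_
  rw [norm_mul, norm_soliton_phase, one_mul, nrm_comp_smul ha two_pos, Complex.norm_real,
    Real.norm_of_nonneg ha.le, ← mul_assoc, sub_eq_add_neg 1 ((n : ℝ) / 2), Real.rpow_add ha,
    Real.rpow_one]

theorem eLpNorm_two_ne_top_of_memH1 {v : Space n → ℂ} (hv : MemH1 v) :
    eLpNorm v 2 volume ≠ ⊤ ∧ eLpNorm (weakGrad v) 2 volume ≠ ⊤ := by
  obtain ⟨hv2, g, hg, hg2⟩ := hv
  exact ⟨hv2.eLpNorm_ne_top, by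
    rw [eLpNorm_congr_ae hg.weakGrad_ae_eq]
    exact hg2.eLpNorm_ne_top⟩

theorem toReal_gnProduct (v : Space n → ℂ) :
    (gnProduct p v).toReal = nrm 2 (weakGrad v) ^ ((n : ℝ) * (p - 1) / 2) *
      nrm 2 v ^ (2 - ((n : ℝ) - 2) * (p - 1) / 2) := by
  simp [gnProduct, nrm, ENNReal.toReal_mul, ENNReal.toReal_rpow]

theorem gnProduct_ne_top (hb : 0 ≤ (n : ℝ) * (p - 1) / 2)
    (hc : 0 ≤ 2 - ((n : ℝ) - 2) * (p - 1) / 2) {v : Space n → ℂ} (hv : MemH1 v) :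
    gnProduct p v ≠ ⊤ :=
  ENNReal.mul_ne_top
    (ENNReal.rpow_ne_top_of_nonneg hb (eLpNorm_two_ne_top_of_memH1 hv).2)
    (ENNReal.rpow_ne_top_of_nonneg hc (eLpNorm_two_ne_top_of_memH1 hv).1)

/-- The sharp constant is admissible in the Gagliardo-Nirenberg inequality. -/
theorem eLpNorm_rpow_le_gnConst_mul (hC : gnConst n p ≠ ⊤) (hb : 0 ≤ (n : ℝ) * (p - 1) / 2)
    (hc : 0 ≤ 2 - ((n : ℝ) - 2) * (p - 1) / 2) {v : Space n → ℂ} (hv : MemH1 v) :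
    eLpNorm v (ENNReal.ofReal (p + 1)) volume ^ (p + 1) ≤ gnConst n p * gnProduct p v := by
  -- Division by the product passes to the infimum. If the product vanishes, one finite admissible
  -- constant already forces the left side to be 0.
  by_cases h0 : gnProduct p v = 0
  · obtain ⟨C, hCS, -⟩ := sInf_lt_iff.1 (lt_top_iff_ne_top.2 hC)
    have := hCS v hv
    simpa [h0] using this
  · rw [← ENNReal.div_le_iff h0 (gnProduct_ne_top hb hc hv)]
    refine le_sInf fun C hCS => ?_
    rw [ENNReal.div_le_iff h0 (gnProduct_ne_top hb hc hv)]
    exact hCS v hv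

theorem IsGroundState.nrm_pos (hQ : IsGroundState p Q) :
    0 < nrm 2 (fun x => (Q x : ℂ)) := by
  refine ENNReal.toReal_pos (fun h => ?_) ?_
  · rw [ENNReal.ofReal_ofNat, eLpNorm_eq_zero_iff hQ.memH1.1.1 two_ne_zero] at h
    have h1 : ∀ᵐ _x : Space n, False := by
      filter_upwards [h] with x hx
      exact (hQ.pos x).ne' (by simpa using hx)
    exact NeZero.ne (volume : Measure (Space n)) (by simpa using h1)
  · rw [ENNReal.ofReal_ofNat]
    exact hQ.memH1.1.eLpNorm_ne_top

/-- Finiteness comes from the ground state itself: an infinite constant would make its `L^{p+1}`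
norm infinite, hence 0 as a real number, against the normalization `norm_pow`. -/
theorem IsGroundState.gnConst_ne_top (hQ : IsGroundState p Q) (hp : 0 < p + 1) :
    gnConst n p ≠ ⊤ := by
  intro h
  have hq := hQ.nrm_pos
  have hgq : 0 < nrm 2 (weakGrad fun x => (Q x : ℂ)) := hQ.norm_grad ▸ hq
  have hP : 0 < (gnProduct p fun x => (Q x : ℂ)).toReal := by
    rw [toReal_gnProduct]
    positivity
  have h1 := hQ.optimal
  rw [h, ENNReal.top_mul (fun h0 => by simp [h0] at hP)] at h1
  have h2 := hQ.norm_pow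
  rw [nrm, ENNReal.toReal_rpow, h1, ENNReal.toReal_top] at h2
  have : 0 < (p + 1) / 2 * nrm 2 (fun x => (Q x : ℂ)) ^ 2 := by positivity
  linarith

/-- The Gagliardo-Nirenberg inequality with the sharp constant, for real-valued norms. -/
theorem nrm_rpow_le_gnConst_mul (hC : gnConst n p ≠ ⊤) (hb : 0 ≤ (n : ℝ) * (p - 1) / 2)
    (hc : 0 ≤ 2 - ((n : ℝ) - 2) * (p - 1) / 2) {v : Space n → ℂ} (hv : MemH1 v) :
    nrm (p + 1) v ^ (p + 1) ≤ (gnConst n p).toReal *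
      (nrm 2 (weakGrad v) ^ ((n : ℝ) * (p - 1) / 2) *
        nrm 2 v ^ (2 - ((n : ℝ) - 2) * (p - 1) / 2)) := by
  rw [← toReal_gnProduct, ← ENNReal.toReal_mul, nrm, ENNReal.toReal_rpow]
  exact ENNReal.toReal_mono (ENNReal.mul_ne_top hC (gnProduct_ne_top hb hc hv))
    (eLpNorm_rpow_le_gnConst_mul hC hb hc hv)

/-- Equality in the Gagliardo-Nirenberg inequality is inherited by the soliton. -/
theorem IsGroundState.nrm_soliton_rpow (hQ : IsGroundState p Q) (hp : 0 < p + 1)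
    (ha : 0 < √((n : ℝ) * (p - 1)) / 2) (t : ℝ) :
    nrm (p + 1) (soliton p Q t) ^ (p + 1) = (gnConst n p).toReal *
      (nrm 2 (weakGrad (soliton p Q t)) ^ ((n : ℝ) * (p - 1) / 2) *
        nrm 2 (soliton p Q t) ^ (2 - ((n : ℝ) - 2) * (p - 1) / 2)) := by
  have h1 := congrArg ENNReal.toReal hQ.optimal
  rw [ENNReal.toReal_mul, toReal_gnProduct, ← ENNReal.toReal_rpow] at h1
  change nrm (p + 1) (fun x => (Q x : ℂ)) ^ (p + 1) = _ at h1
  rw [nrm_soliton hp ha, nrm_soliton two_pos ha, nrm_weakGrad_soliton hQ.memH1 ha]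
  generalize √((n : ℝ) * (p - 1)) / 2 = α at *
  rw [Real.mul_rpow (by positivity) (nrm_nonneg _ _), h1,
    Real.mul_rpow (by positivity) (nrm_nonneg _ _),
    Real.mul_rpow (by positivity) (nrm_nonneg _ _), ← Real.rpow_mul ha.le,
    ← Real.rpow_mul ha.le, ← Real.rpow_mul ha.le]
  -- Dilation invariance of the inequality: both sides scale as `α^(-n)`.
  have h2 : -((n : ℝ) / (p + 1)) * (p + 1) = (1 - (n : ℝ) / 2) * ((n : ℝ) * (p - 1) / 2) +
      -((n : ℝ) / 2) * (2 - ((n : ℝ) - 2) * (p - 1) / 2) := by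
    field_simp
    ring
  rw [h2, Real.rpow_add ha]
  ring

end GroundState

end EMNLS

/-! ### The scalar dichotomy and the exponents. -/

namespace EMNLS

theorem signedPow_mul {t : ℝ} (ht : 0 < t) (E s : ℝ) :
    signedPow (E * t) s = signedPow E s * t ^ s := by
  unfold signedPow
  by_cases hE : 0 ≤ E
  · rw [if_pos hE, if_pos (by positivity), Real.mul_rpow hE ht.le]
  · have hE' : ¬ 0 ≤ E * t := not_le.2 (mul_neg_of_neg_of_pos (not_le.1 hE) ht)
    rw [if_neg hE, if_neg hE', ← neg_mul, Real.mul_rpow (by linarith) ht.le, neg_mul]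

theorem signedPow_mono {s : ℝ} (hs : 0 ≤ s) : Monotone fun E => signedPow E s := by
  intro a b hab
  simp only [signedPow]
  split_ifs with ha hb hb
  · exact Real.rpow_le_rpow ha hab hs
  · exact absurd (ha.trans hab) hb
  · exact (neg_nonpos.2 (Real.rpow_nonneg (by linarith) s)).trans (Real.rpow_nonneg hb s)
  · exact neg_le_neg (Real.rpow_le_rpow (by linarith) (by linarith) hs)

/-- With `x = ‖∇|u|‖₂`, `y = ‖∇_A u‖₂`, `m = ‖u‖₂` and `N = ‖u‖_{p+1}^{p+1}`: a function below an
optimizer `(x₀, m₀)` of the Gagliardo-Nirenberg inequality has `x^s m^(1-s) ≠ x₀^s m₀^(1-s)`, and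
if its `x^s m^(1-s)` is smaller, so is `y^s m^(1-s)`. -/
theorem kinetic_dichotomy {s r b c C κ N x y m x₀ m₀ : ℝ} (hs : 0 < s) (hs1 : s < 1)
    (hb0 : 0 ≤ b) (hb : b = 2 + s * r) (hc : c = (1 - s) * r) (hC : 0 ≤ C) (hκ : 0 ≤ κ)
    (hx : 0 ≤ x) (hxy : x ≤ y) (hm : 0 ≤ m) (hx₀ : 0 < x₀) (hm₀ : 0 < m₀)
    (hN : N ≤ C * (x ^ b * m ^ c))
    (hE : signedPow (1 / 2 * y ^ 2 - κ * N) s * m ^ (2 * (1 - s)) <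
      signedPow (1 / 2 * x₀ ^ 2 - κ * (C * (x₀ ^ b * m₀ ^ c))) s * m₀ ^ (2 * (1 - s))) :
    x ^ s * m ^ (1 - s) ≠ x₀ ^ s * m₀ ^ (1 - s) ∧
      (x ^ s * m ^ (1 - s) < x₀ ^ s * m₀ ^ (1 - s) →
        y ^ s * m ^ (1 - s) < x₀ ^ s * m₀ ^ (1 - s)) := by
  have hpos : 0 < x₀ ^ s * m₀ ^ (1 - s) := by positivity
  -- For `m = 0` both kinetic quantities of `u` vanish, as `1 - s > 0`.
  rcases hm.eq_or_lt with rfl | hm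
  · rw [Real.zero_rpow (by linarith), mul_zero, mul_zero]
    exact ⟨hpos.ne, fun _ => hpos⟩
  have hy : 0 ≤ y := hx.trans hxy
  have hM : ∀ {k : ℝ}, 0 < k → 0 < k ^ ((1 - s) / s) := fun hk => Real.rpow_pos_of_pos hk _
  have hK : ∀ {z k : ℝ}, 0 ≤ z → 0 < k →
      z ^ s * k ^ (1 - s) = (z * k ^ ((1 - s) / s)) ^ s := by
    intro z k hz hk
    rw [Real.mul_rpow hz (hM hk).le, ← Real.rpow_mul hk.le, div_mul_cancel₀ _ hs.ne']
  have hmass : ∀ {k : ℝ}, 0 < k → k ^ (2 * (1 - s)) = ((k ^ ((1 - s) / s)) ^ 2) ^ s := by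
    intro k hk
    rw [← Real.rpow_natCast, ← Real.rpow_mul hk.le, ← Real.rpow_mul hk.le]
    congr 1
    push_cast
    field_simp
  -- The exponents match because `b(1-s)/s = c + 2(1-s)/s`, so mass and gradient merge into one
  -- variable.
  have hGN : ∀ {z k : ℝ}, 0 ≤ z → 0 < k →
      z ^ b * k ^ c * (k ^ ((1 - s) / s)) ^ 2 = (z * k ^ ((1 - s) / s)) ^ b := by
    intro z k hz hk
    rw [Real.mul_rpow hz (hM hk).le, mul_assoc, ← Real.rpow_natCast (k ^ ((1 - s) / s)),
      ← Real.rpow_mul hk.le, ← Real.rpow_mul hk.le, ← Real.rpow_add hk]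
    congr 2
    rw [hb, hc]
    push_cast
    field_simp
    ring
  rw [hmass hm, hmass hm₀, ← signedPow_mul (pow_pos (hM hm) 2),
    ← signedPow_mul (pow_pos (hM hm₀) 2)] at hE
  -- With the mass absorbed into the energy, monotonicity of the odd power strips off the exponent
  -- `s`, whatever the signs of the energies.
  have hE' := (signedPow_mono hs.le).reflect_lt hE
  rw [hK hx hm, hK hx₀.le hm₀, hK hy hm]
  have g1 := hGN hx hm
  have g0 := hGN hx₀.le hm₀
  have hN' : N * (m ^ ((1 - s) / s)) ^ 2 ≤ C * (x * m ^ ((1 - s) / s)) ^ b := by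
    rw [← g1, ← mul_assoc]
    exact mul_le_mul_of_nonneg_right hN (sq_nonneg _)
  have hκN := mul_le_mul_of_nonneg_left hN' hκ
  have hX : 0 ≤ x * m ^ ((1 - s) / s) := mul_nonneg hx (hM hm).le
  have hY : 0 ≤ y * m ^ ((1 - s) / s) := mul_nonneg hy (hM hm).le
  have hX₀ : 0 ≤ x₀ * m₀ ^ ((1 - s) / s) := mul_nonneg hx₀.le (hM hm₀).le
  have hXY : x * m ^ ((1 - s) / s) ≤ y * m ^ ((1 - s) / s) :=
    mul_le_mul_of_nonneg_right hxy (hM hm).le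
  have hE'' : 1 / 2 * (y * m ^ ((1 - s) / s)) ^ 2 - κ * (C * (x * m ^ ((1 - s) / s)) ^ b) <
      1 / 2 * (x₀ * m₀ ^ ((1 - s) / s)) ^ 2 - κ * (C * (x₀ * m₀ ^ ((1 - s) / s)) ^ b) := by
    rw [← g0]
    linear_combination hE' + hκN
  generalize x * m ^ ((1 - s) / s) = X at *
  generalize y * m ^ ((1 - s) / s) = Y at *
  generalize x₀ * m₀ ^ ((1 - s) / s) = X₀ at *
  constructor
  · intro h
    have h' : X = X₀ := (Real.rpow_left_inj hX hX₀ hs.ne').1 h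
    subst h'
    nlinarith
  · intro h
    rw [Real.rpow_lt_rpow_iff hX hX₀ hs] at h
    rw [Real.rpow_lt_rpow_iff hY hX₀ hs]
    have h3 := mul_le_mul_of_nonneg_left
      (mul_le_mul_of_nonneg_left (Real.rpow_le_rpow hX h.le hb0) hC) hκ
    refine lt_of_pow_lt_pow_left₀ 2 hX₀ ?_
    linarith

/-- The two identities are the hypotheses on `b` and `c` in `kinetic_dichotomy`, with `r = p - 1`;
the lower and upper bounds on `p` then give `s_c > 0` and `s_c < 1` respectively. -/
theorem exponent_bounds {n : ℕ} (hn : 3 ≤ n) {p : ℝ} (hp_lower : 1 + 4 / (n : ℝ) < p)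
    (hp_upper : p < 1 + 4 / ((n : ℝ) - 2)) :
    1 < p ∧ 0 < sc n p ∧ sc n p < 1 ∧ 0 ≤ 2 - ((n : ℝ) - 2) * (p - 1) / 2 ∧
      (n : ℝ) * (p - 1) / 2 = 2 + sc n p * (p - 1) ∧
      2 - ((n : ℝ) - 2) * (p - 1) / 2 = (1 - sc n p) * (p - 1) := by
  have hn' : (3 : ℝ) ≤ n := by exact_mod_cast hn
  have h4 : 0 < 4 / (n : ℝ) := by positivity
  have hp1 : 0 < p - 1 := by linarith
  have h1 : 4 < (p - 1) * n := by
    rw [← div_lt_iff₀ (by linarith)]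
    linarith
  have h2 : (p - 1) * (n - 2) < 4 := by
    rw [← lt_div_iff₀ (by linarith)]
    linarith
  have hb : (n : ℝ) * (p - 1) / 2 = 2 + sc n p * (p - 1) := by
    unfold sc
    field_simp
    ring
  have hc : 2 - ((n : ℝ) - 2) * (p - 1) / 2 = (1 - sc n p) * (p - 1) := by
    linear_combination -hb
  refine ⟨by linarith, ?_, ?_, by linarith, hb, hc⟩
  · exact pos_of_mul_pos_left (b := p - 1) (by linarith) hp1.le
  · have : 0 < 1 - sc n p := pos_of_mul_pos_left (b := p - 1) (by linarith) hp1.le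
    linarith

end EMNLS

/-! ### The Double Cut Lemma. -/

theorem lemma3p2 (n : ℕ) (hn : 3 ≤ n) (p : ℝ)
    (hp_lower : 1 + 4 / (n : ℝ) < p) (hp_upper : p < 1 + 4 / ((n : ℝ) - 2))
    (Q : EMNLS.Space n → ℝ) (hQ : EMNLS.IsGroundState p Q) (t : ℝ)
    (A : EMNLS.Space n → EMNLS.Space n) (hA : EMNLS.MemL2Loc A) :
    (∀ u : MeasureTheory.Lp ℂ 2 (MeasureTheory.volume : MeasureTheory.Measure (EMNLS.Space n)),
      EMNLS.MemH1A A u →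
        MeasureTheory.MemLp u (ENNReal.ofReal (p + 1)) MeasureTheory.volume ∧
          EMNLS.MemH1 (EMNLS.modulus u)) ∧
    ∃ R₁ R₂ : Set (MeasureTheory.Lp ℂ 2
        (MeasureTheory.volume : MeasureTheory.Measure (EMNLS.Space n))),
      Disjoint R₁ R₂ ∧
      EMNLS.belowSet p A (EMNLS.soliton p Q t) = R₁ ∪ R₂ ∧
      (∀ u ∈ R₁,
        EMNLS.kinetic p (EMNLS.weakGrad (EMNLS.modulus u)) u ≤
            EMNLS.kinetic p (EMNLS.magGrad A u) u ∧
          EMNLS.kinetic p (EMNLS.magGrad A u) u <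
            EMNLS.kinetic p (EMNLS.weakGrad (EMNLS.soliton p Q t)) (EMNLS.soliton p Q t)) ∧
      (∀ u ∈ R₂,
        EMNLS.kinetic p (EMNLS.weakGrad (EMNLS.soliton p Q t)) (EMNLS.soliton p Q t) <
            EMNLS.kinetic p (EMNLS.weakGrad (EMNLS.modulus u)) u ∧
          EMNLS.kinetic p (EMNLS.weakGrad (EMNLS.modulus u)) u ≤
            EMNLS.kinetic p (EMNLS.magGrad A u) u) := by

  obtain ⟨hp1, hs, hs1, hc0, hb, hc⟩ := EMNLS.exponent_bounds hn hp_lower hp_upper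
  have hb0 : 0 ≤ (n : ℝ) * (p - 1) / 2 :=
    div_nonneg (mul_nonneg n.cast_nonneg (by linarith)) two_pos.le
  have hn0 : 0 < (n : ℝ) := by exact_mod_cast (by omega : 0 < n)
  have ha : 0 < √((n : ℝ) * (p - 1)) / 2 :=
    half_pos (Real.sqrt_pos.2 (mul_pos hn0 (by linarith)))
  have hC := hQ.gnConst_ne_top (by linarith)
  have hm₀ : 0 < EMNLS.nrm 2 (EMNLS.soliton p Q t) := by
    rw [EMNLS.nrm_soliton two_pos ha]
    exact mul_pos (Real.rpow_pos_of_pos ha _) hQ.nrm_pos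
  have hx₀ : 0 < EMNLS.nrm 2 (EMNLS.weakGrad (EMNLS.soliton p Q t)) := by
    rw [EMNLS.nrm_weakGrad_soliton hQ.memH1 ha, hQ.norm_grad]
    exact mul_pos (Real.rpow_pos_of_pos ha _) hQ.nrm_pos
  have hle : ∀ u : Lp ℂ 2 (volume : Measure (EMNLS.Space n)), EMNLS.MemH1A A u →
      EMNLS.kinetic p (EMNLS.weakGrad (EMNLS.modulus u)) u ≤
        EMNLS.kinetic p (EMNLS.magGrad A u) u := fun u hu =>
    mul_le_mul_of_nonneg_right (Real.rpow_le_rpow (EMNLS.nrm_nonneg _ _)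
      hu.nrm_weakGrad_modulus_le hs.le) (Real.rpow_nonneg (EMNLS.nrm_nonneg _ _) _)
  have key : ∀ u ∈ EMNLS.belowSet p A (EMNLS.soliton p Q t),
      EMNLS.kinetic p (EMNLS.weakGrad (EMNLS.modulus u)) u ≠
        EMNLS.kinetic p (EMNLS.weakGrad (EMNLS.soliton p Q t)) (EMNLS.soliton p Q t) ∧
      (EMNLS.kinetic p (EMNLS.weakGrad (EMNLS.modulus u)) u <
        EMNLS.kinetic p (EMNLS.weakGrad (EMNLS.soliton p Q t)) (EMNLS.soliton p Q t) →
      EMNLS.kinetic p (EMNLS.magGrad A u) u <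
        EMNLS.kinetic p (EMNLS.weakGrad (EMNLS.soliton p Q t)) (EMNLS.soliton p Q t)) := by
    rintro u ⟨hu, hE⟩
    have hGN := EMNLS.nrm_rpow_le_gnConst_mul hC hb0 hc0 hu.memH1_modulus
    have hmod : ∀ q, EMNLS.nrm q (EMNLS.modulus u) = EMNLS.nrm q u := fun q =>
      congrArg ENNReal.toReal (EMNLS.eLpNorm_modulus u _)
    rw [hmod, hmod] at hGN
    rw [EMNLS.magEnergy, EMNLS.energy, hQ.nrm_soliton_rpow (by linarith) ha] at hE
    exact EMNLS.kinetic_dichotomy hs hs1 hb0 hb hc ENNReal.toReal_nonneg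
      (one_div_nonneg.2 (by linarith)) (EMNLS.nrm_nonneg _ _) hu.nrm_weakGrad_modulus_le
      (EMNLS.nrm_nonneg _ _) hx₀ hm₀ hGN hE
  refine ⟨fun u hu => ⟨⟨hu.1.1, ?_⟩, hu.memH1_modulus⟩,
    {u | u ∈ EMNLS.belowSet p A (EMNLS.soliton p Q t) ∧
      EMNLS.kinetic p (EMNLS.weakGrad (EMNLS.modulus u)) u <
        EMNLS.kinetic p (EMNLS.weakGrad (EMNLS.soliton p Q t)) (EMNLS.soliton p Q t)},
    {u | u ∈ EMNLS.belowSet p A (EMNLS.soliton p Q t) ∧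
      EMNLS.kinetic p (EMNLS.weakGrad (EMNLS.soliton p Q t)) (EMNLS.soliton p Q t) <
        EMNLS.kinetic p (EMNLS.weakGrad (EMNLS.modulus u)) u},
    ?_, ?_, fun u hu => ⟨hle u hu.1.1, (key u hu.1).2 hu.2⟩,
    fun u hu => ⟨hu.2, hle u hu.1.1⟩⟩
  · have h1 := EMNLS.eLpNorm_rpow_le_gnConst_mul hC hb0 hc0 hu.memH1_modulus
    rw [EMNLS.eLpNorm_modulus] at h1
    have h2 := h1.trans_lt (ENNReal.mul_lt_top (lt_top_iff_ne_top.2 hC)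
      (lt_top_iff_ne_top.2 (EMNLS.gnProduct_ne_top hb0 hc0 hu.memH1_modulus)))
    exact (ENNReal.rpow_lt_top_iff_of_pos (by linarith)).1 h2
  · exact Set.disjoint_left.2 fun u h1 h2 => lt_asymm h1.2 h2.2
  · ext u
    constructor
    · intro hu
      rcases lt_or_gt_of_ne (key u hu).1 with h | h
      · exact Or.inl ⟨hu, h⟩
      · exact Or.inr ⟨hu, h⟩
    · rintro (hu | hu)
      exacts [hu.1, hu.1]
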